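/- Let $A\in\mathbb{R}^{N\times T}$ and $W\in\mathbb{R}^{T\times d}$ be real matrices. Let $A_k=\sum_{i\le k}\sigma_i u_i v_i^{\top}$ be the approximation of $A$ by its $k$ largest singular values, taken from any singular value decomposition $A=\sum_{i=1}^{r}\sigma_i u_i v_i^{\top}$ with $r=\operatorname{rank}A$ and $\sigma_1\ge\dots\ge\sigma_r>0$ (with $A_k=A$ if $k\ge r$). Let $\mu(A)=\max_{1\le j\le T}\sum_{i\le \min(k,r)}(v_i)_j^2$ be the corresponding (rank-$k$) coherence of $A$, i.e. its largest column leverage score. For $S<T$ choose $S$ of the $T$ columns of $A$ uniformly at random, and let $A'=A\mathbf{S}^{\top}\in\mathbb{R}^{N\times S}$ be the matrix of the chosen columns, where $\mathbf{S}\in\{0,1\}^{S\times T}$ is the corresponding masking matrix. Put $P_{A'}(A)=A'(A')^{\dagger}A$, where $(A')^{\dagger}$ is the Moore–Penrose inverse, and let $\|\cdot\|_F$ be the Frobenius norm. If the coherence of $A$ is of order $k/T$ and $S$ is of order $k^2/\epsilon^2$, then with high probability $$\|AW-P_{A'}(A)W\|_F\le(1+\epsilon)\,\|W\|_F\,\|A-A_k\|_F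 .$$ Precisely: for every $c>0$ and every $\delta\in(0,1)$ there is a constant $C>0$, depending only on $c$ and $\delta$, such that for all $N,T,d,k\ge 0$, all $A$ and $W$ as above, every $\epsilon\in(0,1]$ and every $S<T$, if $\mu(A)\le c\,k/T$ and $S\ge C\,k^2/\epsilon^2$, then the displayed inequality holds with probability at least $1-\delta$. This is true both when the $S$ columns are drawn without replacement and when they are drawn independently with replacement. -/

import Mathlib

open scoped Matrix Matrix.Norms.Frobenius

/-- The four Penrose equations: `X` is a Moore-Penrose inverse of the real matrix `B`. -/
structure IsMoorePenrose {m n : Type*} [Fintype m] [Fintype n]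
    (B : Matrix m n ℝ) (X : Matrix n m ℝ) : Prop where
  mul_mul_self : B * X * B = B
  self_mul_mul : X * B * X = X
  symm_left : (B * X)ᵀ = B * X
  symm_right : (X * B)ᵀ = X * B

theorem IsMoorePenrose.unique {m n : Type*} [Fintype m] [Fintype n]
    {B : Matrix m n ℝ} {X Y : Matrix n m ℝ}
    (hX : IsMoorePenrose B X) (hY : IsMoorePenrose B Y) : X = Y := by
  have h1 : B * X = B * Y := by
    calc B * X = (B * X)ᵀ := hX.symm_left.symm
      _ = (B * Y * B * X)ᵀ := by rw [hY.mul_mul_self]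
      _ = (B * X)ᵀ * (B * Y)ᵀ := by rw [← Matrix.transpose_mul]; simp only [Matrix.mul_assoc]
      _ = B * X * B * Y := by rw [hX.symm_left, hY.symm_left]; simp only [Matrix.mul_assoc]
      _ = B * Y := by rw [hX.mul_mul_self]
  have h2 : X * B = Y * B := by
    calc X * B = (X * B)ᵀ := hX.symm_right.symm
      _ = (X * (B * Y * B))ᵀ := by rw [hY.mul_mul_self]
      _ = (Y * B)ᵀ * (X * B)ᵀ := by rw [← Matrix.transpose_mul]; simp only [Matrix.mul_assoc]
      _ = Y * (B * X * B) := by rw [hX.symm_right, hY.symm_right]; simp only [Matrix.mul_assoc]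
      _ = Y * B := by rw [hX.mul_mul_self]
  calc X = X * B * X := hX.self_mul_mul.symm
    _ = Y * (B * X) := by rw [h2, Matrix.mul_assoc]
    _ = Y := by rw [h1, ← Matrix.mul_assoc, hY.self_mul_mul]

theorem exists_isMoorePenrose {m n : Type*} [Fintype m] [Fintype n]
    (B : Matrix m n ℝ) : ∃ X : Matrix n m ℝ, IsMoorePenrose B X := by
  classical
  have hH : (Bᵀ * B).IsHermitian := by
    simpa [Matrix.conjTranspose_eq_transpose_of_trivial] using
      Matrix.isHermitian_conjTranspose_mul_self B
  obtain ⟨Q, l, hQ, hQ', hG⟩ : ∃ (Q : Matrix n n ℝ) (l : n → ℝ),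
      Qᵀ * Q = 1 ∧ Q * Qᵀ = 1 ∧ Bᵀ * B = Q * Matrix.diagonal l * Qᵀ := by
    refine ⟨hH.eigenvectorUnitary, hH.eigenvalues, ?_, ?_, ?_⟩
    · have := Unitary.coe_star_mul_self hH.eigenvectorUnitary
      simpa [Matrix.star_eq_conjTranspose] using this
    · have := Unitary.coe_mul_star_self hH.eigenvectorUnitary
      simpa [Matrix.star_eq_conjTranspose] using this
    · have := hH.spectral_theorem
      simpa [Unitary.conjStarAlgAut_apply, Matrix.star_eq_conjTranspose, Function.comp_def] using this
  set P : Matrix n n ℝ := Q * Matrix.diagonal (fun i => (l i)⁻¹) * Qᵀ with hP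
  have hPT : Pᵀ = P := by simp [hP, Matrix.mul_assoc]
  have hGT : (Bᵀ * B)ᵀ = Bᵀ * B := by simp
  have cancel (D E : Matrix n n ℝ) : (Q * D * Qᵀ) * (Q * E * Qᵀ) = Q * (D * E) * Qᵀ := by
    calc (Q * D * Qᵀ) * (Q * E * Qᵀ) = Q * D * (Qᵀ * Q) * E * Qᵀ := by
          simp only [Matrix.mul_assoc]
      _ = _ := by rw [hQ]; simp only [Matrix.mul_assoc, Matrix.one_mul]
  have hGP : (Bᵀ * B) * P = P * (Bᵀ * B) := by
    rw [hG, hP, cancel, cancel, Matrix.diagonal_mul_diagonal, Matrix.diagonal_mul_diagonal]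
    simp only [mul_comm]
  have hGPG : (Bᵀ * B) * P * (Bᵀ * B) = Bᵀ * B := by
    rw [hG, hP, cancel, cancel, Matrix.diagonal_mul_diagonal, Matrix.diagonal_mul_diagonal]
    congr 3; funext i; exact mul_inv_mul_cancel (l i)
  have hPGP : P * (Bᵀ * B) * P = P := by
    rw [hG, hP, cancel, cancel, Matrix.diagonal_mul_diagonal, Matrix.diagonal_mul_diagonal]
    congr 3; funext i; by_cases h : l i = 0 <;> simp [h]
  refine ⟨P * Bᵀ, ?_, ?_, ?_, ?_⟩
  · have hz : Bᵀ * (B * (P * Bᵀ) * B - B) = 0 := by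
      rw [Matrix.mul_sub, sub_eq_zero]
      simpa only [Matrix.mul_assoc] using hGPG
    have hz2 : (B * (P * Bᵀ) * B - B)ᵀ * (B * (P * Bᵀ) * B - B) = 0 := by
      have : B * (P * Bᵀ) * B - B = B * (P * Bᵀ * B - 1) := by
        rw [Matrix.mul_sub, Matrix.mul_one]; simp only [Matrix.mul_assoc]
      nth_rewrite 1 [this]
      rw [Matrix.transpose_mul, Matrix.mul_assoc, hz, Matrix.mul_zero]
    rw [← Matrix.conjTranspose_eq_transpose_of_trivial,
      Matrix.conjTranspose_mul_self_eq_zero] at hz2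
    exact sub_eq_zero.mp hz2
  · calc P * Bᵀ * B * (P * Bᵀ) = P * (Bᵀ * B) * P * Bᵀ := by simp only [Matrix.mul_assoc]
      _ = _ := by rw [hPGP]
  · simp [Matrix.transpose_mul, hPT, Matrix.mul_assoc]
  · calc (P * Bᵀ * B)ᵀ = (Bᵀ * B) * P := by
          rw [Matrix.mul_assoc, Matrix.transpose_mul, hGT, hPT]
      _ = P * Bᵀ * B := by rw [hGP, Matrix.mul_assoc P]

/-- The Moore-Penrose inverse `B†`: the unique matrix satisfying the Penrose equations. -/
noncomputable def pinv {m n : Type*} [Fintype m] [Fintype n] (B : Matrix m n ℝ) : Matrix n m ℝ :=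
  Classical.choose (exists_isMoorePenrose B)

theorem pinv_spec {m n : Type*} [Fintype m] [Fintype n] (B : Matrix m n ℝ) :
    IsMoorePenrose B (pinv B) :=
  Classical.choose_spec (exists_isMoorePenrose B)

/-- The 0-1 masking matrix whose `i`-th row selects the index `τ i`. -/
def maskMatrix {S T : ℕ} (τ : Fin S → Fin T) : Matrix (Fin S) (Fin T) ℝ :=
  Matrix.of fun i j => if τ i = j then 1 else 0

/-- `A' = A Sᵀ`: the matrix whose columns are the selected columns of `A`. -/
def sampledColumns {N T S : ℕ} (A : Matrix (Fin N) (Fin T) ℝ) (τ : Fin S → Fin T) :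
    Matrix (Fin N) (Fin S) ℝ :=
  A * (maskMatrix τ)ᵀ

/-- `P_{A'}(A) = A' A'† A`: every column of `A` projected onto the column space of `A'`. -/
noncomputable def columnProjection {N S T : ℕ} (A' : Matrix (Fin N) (Fin S) ℝ)
    (A : Matrix (Fin N) (Fin T) ℝ) : Matrix (Fin N) (Fin T) ℝ :=
  A' * pinv A' * A

/-- A compact singular value decomposition `A = U diag(σ) Vᵀ`, with orthonormal columns of `U`
and `V` and positive singular values in decreasing order (so `r` is the rank of `A`). -/
structure CompactSVD {N T : ℕ} (A : Matrix (Fin N) (Fin T) ℝ) where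
  r : ℕ
  U : Matrix (Fin N) (Fin r) ℝ
  V : Matrix (Fin T) (Fin r) ℝ
  σ : Fin r → ℝ
  U_orthonormal : Uᵀ * U = 1
  V_orthonormal : Vᵀ * V = 1
  σ_pos : ∀ i, 0 < σ i
  σ_antitone : Antitone σ
  eq_mul : A = U * Matrix.diagonal σ * Vᵀ

/-- `A_k`: the part of the decomposition that belongs to the `k` largest singular values. -/
def CompactSVD.truncate {N T : ℕ} {A : Matrix (Fin N) (Fin T) ℝ} (D : CompactSVD A) (k : ℕ) :
    Matrix (Fin N) (Fin T) ℝ :=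
  D.U * Matrix.diagonal (fun i : Fin D.r => if (i : ℕ) < k then D.σ i else 0) * D.Vᵀ

/-- The coherence of `A` relative to rank `k`: the largest column leverage score, that is the
largest squared norm of a row of the matrix `V_k` of the top `k` right singular vectors. -/
noncomputable def CompactSVD.coherence {N T : ℕ} {A : Matrix (Fin N) (Fin T) ℝ}
    (D : CompactSVD A) (k : ℕ) : ℝ :=
  ⨆ j : Fin T, ∑ i : Fin D.r, if (i : ℕ) < k then D.V j i ^ 2 else 0

/-! Write `V` for the top `k` right singular vectors and `E = A - A_k`, so that `Vᵀ * V = 1` and `E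
* V = 0`. For `S > 0`, sampling the inner index and rescaling by `T / S` gives unbiased estimators
`G` of `Vᵀ * V` and `M` of `E * V`. If `‖G - 1‖ ≤ 1/2` and `‖M‖ ≤ ε/2 * ‖E‖`, some combination of
the sampled columns equals `A_k + M * G⁻¹ * Vᵀ`, within `(1 + ε) * ‖E‖` of `A`; projection does no
worse (`frobenius_norm_sub_columnProjection_le_of_close`), and submultiplicativity brings in `W`.

Both conditions follow from second moments. The estimator of `P * V` has mean squared error at most
`c * k * ‖P‖² / S` (`sum_norm_sq_sampled_mul_topV_le`): `c * k² / S` for `P = Vᵀ` and `c * k * ‖E‖²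
/ S` for `P = E`. Markov's inequality and a union bound finish. Only nonpositive correlation between
distinct draws is used, so `NegExchangeable` covers both sampling schemes. -/

/-! ### Frobenius norm estimates -/

section Frobenius

variable {l m n : Type*} [Fintype l] [Fintype m] [Fintype n]

theorem frobenius_norm_sq (A : Matrix m n ℝ) : ‖A‖ ^ 2 = ∑ i, ∑ j, A i j ^ 2 := by
  rw [Matrix.frobenius_norm_def, ← Real.sqrt_eq_rpow, Real.sq_sqrt]
  · simp
  · positivity

theorem frobenius_norm_sq_eq_trace (A : Matrix m n ℝ) : ‖A‖ ^ 2 = (Aᵀ * A).trace := by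
  rw [frobenius_norm_sq, Finset.sum_comm]
  simp [Matrix.trace, Matrix.mul_apply, sq]

theorem frobenius_norm_mul_transpose_of_orthonormal [DecidableEq n] {V : Matrix m n ℝ}
    (hV : Vᵀ * V = 1) (Z : Matrix l n ℝ) : ‖Z * Vᵀ‖ = ‖Z‖ := by
  rw [← sq_eq_sq₀ (norm_nonneg _) (norm_nonneg _), frobenius_norm_sq_eq_trace,
    frobenius_norm_sq_eq_trace, Matrix.transpose_mul, Matrix.transpose_transpose,
    Matrix.mul_assoc, Matrix.trace_mul_comm]
  simp only [Matrix.mul_assoc, hV, Matrix.mul_one]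

/-- A symmetric idempotent splits the squared Frobenius norm, so its complement is contractive. -/
theorem frobenius_norm_sub_mul_le {P : Matrix m m ℝ} (hP : Pᵀ = P) (hPP : P * P = P)
    (M : Matrix m n ℝ) : ‖M - P * M‖ ≤ ‖M‖ := by
  rw [← sq_le_sq₀ (norm_nonneg _) (norm_nonneg _)]
  have h : ‖M - P * M‖ ^ 2 = ‖M‖ ^ 2 - ‖P * M‖ ^ 2 := by
    simp only [frobenius_norm_sq_eq_trace, Matrix.transpose_sub, Matrix.transpose_mul, hP]
    have h1 : Mᵀ * P * (P * M) = Mᵀ * (P * M) := by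
      rw [Matrix.mul_assoc, ← Matrix.mul_assoc P P M, hPP]
    rw [Matrix.sub_mul, Matrix.mul_sub, Matrix.mul_sub, h1, Matrix.mul_assoc, sub_self, sub_zero,
      Matrix.trace_sub]
  rw [h]
  linarith [sq_nonneg ‖P * M‖]

/-- Projecting onto the column space of `A'` is at least as good as any other approximation
with columns in that space. -/
theorem frobenius_norm_sub_columnProjection_le {N S T : ℕ} (A' : Matrix (Fin N) (Fin S) ℝ)
    (A : Matrix (Fin N) (Fin T) ℝ) (X : Matrix (Fin S) (Fin T) ℝ) :
    ‖A - columnProjection A' A‖ ≤ ‖A - A' * X‖ := by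
  have hp := pinv_spec A'
  have hPP : (A' * pinv A') * (A' * pinv A') = A' * pinv A' := by
    rw [← Matrix.mul_assoc, hp.mul_mul_self]
  have h := frobenius_norm_sub_mul_le hp.symm_left hPP (A - A' * X)
  have h2 : A - A' * X - A' * pinv A' * (A - A' * X) = A - columnProjection A' A := by
    rw [Matrix.mul_sub, ← Matrix.mul_assoc (A' * pinv A') A' X, hp.mul_mul_self, columnProjection]
    abel
  rwa [h2] at h

/-- If a Gram matrix of the sampled singular vectors is close to the identity and the residual is
nearly orthogonal to them, then the sampled columns nearly capture the truncated part. -/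
theorem frobenius_norm_sub_columnProjection_le_of_close {N S T : ℕ} [DecidableEq n]
    {A E : Matrix (Fin N) (Fin T) ℝ} {B : Matrix (Fin N) n ℝ} {V : Matrix (Fin T) n ℝ}
    (hV : Vᵀ * V = 1) (hA : A = B * Vᵀ + E) (R : Matrix (Fin T) (Fin S) ℝ) (a ε : ℝ)
    (hG : ‖a • (Vᵀ * R * (Rᵀ * V)) - 1‖ ≤ 1 / 2)
    (hM : ‖a • (E * R * (Rᵀ * V))‖ ≤ ε / 2 * ‖E‖) :
    ‖A - columnProjection (A * R) A‖ ≤ (1 + ε) * ‖E‖ := by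
  set G := a • (Vᵀ * R * (Rᵀ * V)) with hGdef
  set M := a • (E * R * (Rᵀ * V)) with hMdef
  -- Neumann series: `G` is at distance less than 1 from the identity.
  have hunit : IsUnit G := by
    have h := isUnit_one_sub_of_norm_lt_one (x := 1 - G)
      (by rw [norm_sub_rev]; linarith)
    simpa using h
  obtain ⟨H, hGH⟩ := hunit.exists_right_inv
  have hHG : H * G = 1 := mul_eq_one_comm.mp hGH
  have hZ : ‖M * H‖ ≤ ε * ‖E‖ := by
    -- Absorbing `M * H` into itself gives `‖M * H‖ ≤ 2 * ‖M‖` without bounding `‖H‖`, whose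
    -- Frobenius norm may grow with the dimension.
    have h1 : M * H = M - M * H * (G - 1) := by
      rw [Matrix.mul_sub, Matrix.mul_assoc M H G, hHG, Matrix.mul_one, Matrix.mul_one]
      abel
    have h2 : ‖M * H‖ ≤ ‖M‖ + ‖M * H‖ * ‖G - 1‖ := by
      nth_rewrite 1 [h1]
      exact (norm_sub_le _ _).trans (by gcongr; exact Matrix.frobenius_norm_mul _ _)
    nlinarith [norm_nonneg (M * H)]
  have hX : A - A * R * (a • (Rᵀ * V) * H * Vᵀ) = E - M * H * Vᵀ := by
    have h1 : A * R * (a • (Rᵀ * V) * H * Vᵀ) = B * (G * H) * Vᵀ + M * H * Vᵀ := by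
      rw [hA, hGdef, hMdef]
      simp only [Matrix.add_mul, Matrix.mul_assoc, Matrix.mul_smul, Matrix.smul_mul,
        smul_add]
    rw [h1, hGH, Matrix.mul_one, hA]
    abel
  calc ‖A - columnProjection (A * R) A‖
      ≤ ‖A - A * R * (a • (Rᵀ * V) * H * Vᵀ)‖ := frobenius_norm_sub_columnProjection_le _ _ _
    _ = ‖E - M * H * Vᵀ‖ := by rw [hX]
    _ ≤ ‖E‖ + ‖M * H * Vᵀ‖ := norm_sub_le _ _
    _ ≤ (1 + ε) * ‖E‖ := by
      rw [frobenius_norm_mul_transpose_of_orthonormal hV]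
      linarith

end Frobenius

/-! ### Exchangeable, negatively correlated samples -/

/-- A finite set of samples is negatively exchangeable if it is invariant under relabelling and no
pair of draws prefers coinciding values to a given pair of distinct ones. -/
structure NegExchangeable {S T : ℕ} (Ω : Finset (Fin S → Fin T)) : Prop where
  comp_mem : ∀ τ ∈ Ω, ∀ π : Equiv.Perm (Fin T), π ∘ τ ∈ Ω
  card_diag_le : ∀ s s' : Fin S, s ≠ s' → ∀ a b : Fin T, a ≠ b →
    (Ω.filter fun τ => τ s = a ∧ τ s' = a).card ≤ (Ω.filter fun τ => τ s = a ∧ τ s' = b).card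

namespace NegExchangeable

variable {S T : ℕ} {Ω : Finset (Fin S → Fin T)}

theorem sum_comp (h : NegExchangeable Ω) (π : Equiv.Perm (Fin T)) (F : (Fin S → Fin T) → ℝ) :
    ∑ τ ∈ Ω, F (π ∘ τ) = ∑ τ ∈ Ω, F τ := by
  refine Finset.sum_nbij' (fun τ => π ∘ τ) (fun τ => π.symm ∘ τ) ?_ ?_ ?_ ?_ ?_
  · exact fun τ hτ => h.comp_mem τ hτ π
  · exact fun τ hτ => h.comp_mem τ hτ π.symm
  · intro τ _; ext; simp
  · intro τ _; ext; simp
  · intro τ _; rfl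

theorem card_filter_perm (h : NegExchangeable Ω) (π : Equiv.Perm (Fin T)) (s s' : Fin S)
    (a b : Fin T) :
    (Ω.filter fun τ => τ s = π a ∧ τ s' = π b).card =
      (Ω.filter fun τ => τ s = a ∧ τ s' = b).card := by
  have := h.sum_comp π fun τ => if τ s = π a ∧ τ s' = π b then 1 else 0
  simp only [Function.comp_apply, EmbeddingLike.apply_eq_iff_eq, Finset.sum_boole] at this
  exact_mod_cast this.symm

theorem sum_pair_eq (Ω : Finset (Fin S → Fin T)) (s s' : Fin S) (F : Fin T → Fin T → ℝ) :
    ∑ τ ∈ Ω, F (τ s) (τ s') =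
      ∑ a, ∑ b, ((Ω.filter fun τ => τ s = a ∧ τ s' = b).card : ℝ) * F a b := by
  calc ∑ τ ∈ Ω, F (τ s) (τ s')
      = ∑ τ ∈ Ω, ∑ a, ∑ b, if τ s = a ∧ τ s' = b then F a b else 0 := by
        simp [ite_and]
    _ = _ := by
        rw [Finset.sum_comm]
        refine Finset.sum_congr rfl fun a _ => ?_
        rw [Finset.sum_comm]
        refine Finset.sum_congr rfl fun b _ => ?_
        rw [← Finset.sum_filter, Finset.sum_const, nsmul_eq_mul]

/-- Invariance under transpositions makes every single draw uniform. -/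
theorem sum_marginal (h : NegExchangeable Ω) (s : Fin S) (f : Fin T → ℝ) :
    T * ∑ τ ∈ Ω, f (τ s) = Ω.card * ∑ j, f j := by
  have hswap : ∀ a b : Fin T, ∑ τ ∈ Ω, (if τ s = a then 1 else 0 : ℝ) =
      ∑ τ ∈ Ω, (if τ s = b then 1 else 0) := by
    intro a b
    rw [← h.sum_comp (Equiv.swap a b)]
    refine Finset.sum_congr rfl fun τ _ => ?_
    simp [Equiv.swap_apply_eq_iff]
  have hone : ∀ a : Fin T, T * ∑ τ ∈ Ω, (if τ s = a then 1 else 0 : ℝ) = Ω.card := by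
    intro a
    calc T * ∑ τ ∈ Ω, (if τ s = a then 1 else 0 : ℝ)
        = ∑ b : Fin T, ∑ τ ∈ Ω, (if τ s = b then 1 else 0 : ℝ) := by
          rw [Finset.sum_congr rfl fun b _ => hswap b a]
          simp
      _ = _ := by rw [Finset.sum_comm]; simp
  calc T * ∑ τ ∈ Ω, f (τ s)
      = T * ∑ τ ∈ Ω, ∑ a, (if τ s = a then 1 else 0) * f a := by simp
    _ = ∑ a, (T * ∑ τ ∈ Ω, (if τ s = a then 1 else 0)) * f a := by
        rw [Finset.sum_comm, Finset.mul_sum]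
        simp only [← Finset.sum_mul, mul_assoc]
    _ = _ := by simp only [hone, Finset.mul_sum]

/-- Distinct draws of a centered function are nonpositively correlated. -/
theorem sum_mul_nonpos (h : NegExchangeable Ω) {s s' : Fin S} (hs : s ≠ s') {y : Fin T → ℝ}
    (hy : ∑ j, y j = 0) : ∑ τ ∈ Ω, y (τ s) * y (τ s') ≤ 0 := by
  rw [sum_pair_eq Ω s s' fun a b => y a * y b]
  set c : Fin T → Fin T → ℝ := fun a b => ((Ω.filter fun τ => τ s = a ∧ τ s' = b).card : ℝ)
  change ∑ a, ∑ b, c a b * (y a * y b) ≤ 0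
  by_cases hT : ∃ a₀ b₀ : Fin T, a₀ ≠ b₀
  · obtain ⟨a₀, b₀, hab⟩ := hT
    -- Relabelling leaves only two joint counts, diagonal and off-diagonal. The constant part
    -- vanishes against the centered `y`, leaving a nonpositive multiple of `∑ y²`.
    have hc : ∀ a b, c a b = c a₀ b₀ + if a = b then c a₀ a₀ - c a₀ b₀ else 0 := by
      intro a b
      split_ifs with he
      · subst he
        have := h.card_filter_perm (Equiv.swap a₀ a) s s' a₀ a₀
        rw [Equiv.swap_apply_left] at this
        simp only [c, this]
        ring
      · have h1 : Equiv.swap a₀ a b₀ ≠ a := by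
          rw [Ne, Equiv.swap_apply_eq_iff, Equiv.swap_apply_right]
          exact hab.symm
        -- This permutation sends `a₀` to `a` and `b₀` to `b`.
        have := h.card_filter_perm (Equiv.swap (Equiv.swap a₀ a b₀) b * Equiv.swap a₀ a) s s' a₀ b₀
        rw [Equiv.Perm.mul_apply, Equiv.Perm.mul_apply, Equiv.swap_apply_left,
          Equiv.swap_apply_left, Equiv.swap_apply_of_ne_of_ne h1.symm he] at this
        simp only [c, this, add_zero]
    have hle : c a₀ a₀ ≤ c a₀ b₀ := by
      simp only [c]
      exact_mod_cast h.card_diag_le s s' hs a₀ b₀ hab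
    have hsum : ∑ a, ∑ b, c a b * (y a * y b) = (c a₀ a₀ - c a₀ b₀) * ∑ a, y a ^ 2 := by
      calc ∑ a, ∑ b, c a b * (y a * y b)
          = ∑ a, (c a₀ b₀ * y a * ∑ b, y b + (c a₀ a₀ - c a₀ b₀) * y a ^ 2) := by
            refine Finset.sum_congr rfl fun a _ => ?_
            simp only [hc a, add_mul, Finset.sum_add_distrib, ite_mul, zero_mul,
              Finset.sum_ite_eq, Finset.mem_univ, if_true, Finset.mul_sum]
            congr 1
            · exact Finset.sum_congr rfl fun b _ => by ring
            · ring
        _ = _ := by simp only [hy, mul_zero, zero_add, Finset.mul_sum]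
    rw [hsum]
    exact mul_nonpos_of_nonpos_of_nonneg (by linarith) (by positivity)
  · push Not at hT
    have hz : ∀ a, y a = 0 := fun a => by
      rw [← hy]
      exact (Finset.sum_eq_single a (fun b _ hb => absurd (hT b a) hb) (by simp)).symm
    simp [hz]

/-- The rescaled sample sum is an estimator of the total with at most the Monte Carlo variance. -/
theorem sum_sq_estimator_le (h : NegExchangeable Ω) (hS : S ≠ 0) (hT : T ≠ 0) (f : Fin T → ℝ) :
    ∑ τ ∈ Ω, ((T / S : ℝ) * ∑ s, f (τ s) - ∑ j, f j) ^ 2 ≤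
      Ω.card * ((T / S : ℝ) * ∑ j, f j ^ 2) := by
  have hS' : (0 : ℝ) < S := by positivity
  have hT' : (0 : ℝ) < T := by positivity
  obtain ⟨m, hmT⟩ : ∃ m : ℝ, ∑ j, f j = T * m := ⟨(∑ j, f j) / T, by field_simp⟩
  set y : Fin T → ℝ := fun j => f j - m with hy
  have hy0 : ∑ j, y j = 0 := by simp [hy, hmT]
  have hyf : ∑ j, y j ^ 2 ≤ ∑ j, f j ^ 2 := by
    have : ∑ j, y j ^ 2 = ∑ j, f j ^ 2 - T * m ^ 2 := by
      simp only [hy, sub_sq, Finset.sum_add_distrib, Finset.sum_sub_distrib, ← Finset.mul_sum,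
        ← Finset.sum_mul, hmT]
      simp
      ring
    rw [this]
    have : 0 ≤ T * m ^ 2 := by positivity
    linarith
  -- Cross terms are nonpositive; each of the `S` diagonal terms is given by the uniform marginal.
  have hvar : ∑ τ ∈ Ω, (∑ s, y (τ s)) ^ 2 ≤ S * (Ω.card * (∑ j, y j ^ 2) / T) := by
    calc ∑ τ ∈ Ω, (∑ s, y (τ s)) ^ 2
        = ∑ s, ∑ s', ∑ τ ∈ Ω, y (τ s) * y (τ s') := by
          simp only [sq, Finset.sum_mul_sum]
          rw [Finset.sum_comm]
          exact Finset.sum_congr rfl fun s _ => Finset.sum_comm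
      _ ≤ ∑ s : Fin S, ∑ s' : Fin S, if s = s' then Ω.card * (∑ j, y j ^ 2) / T else 0 := by
          refine Finset.sum_le_sum fun s _ => Finset.sum_le_sum fun s' _ => ?_
          split_ifs with hss
          · subst hss
            rw [le_div_iff₀ hT', mul_comm, ← h.sum_marginal s fun j => y j ^ 2]
            simp only [sq, le_refl]
          · exact h.sum_mul_nonpos hss hy0
      _ = _ := by simp
  calc ∑ τ ∈ Ω, ((T / S : ℝ) * ∑ s, f (τ s) - ∑ j, f j) ^ 2
      = (T / S : ℝ) ^ 2 * ∑ τ ∈ Ω, (∑ s, y (τ s)) ^ 2 := by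
        rw [Finset.mul_sum]
        refine Finset.sum_congr rfl fun τ _ => ?_
        rw [← mul_pow]
        congr 1
        simp only [hy, hmT, Finset.sum_sub_distrib, Finset.sum_const, Finset.card_univ,
          Fintype.card_fin, nsmul_eq_mul]
        field_simp
    _ ≤ (T / S : ℝ) ^ 2 * (S * (Ω.card * (∑ j, f j ^ 2) / T)) := by
        gcongr
        exact hvar.trans (by gcongr)
    _ = _ := by field_simp

/-- Approximate matrix multiplication by uniform sampling of the inner index. -/
theorem sum_norm_sq_sampled_mul_le {m n : Type*} [Fintype m] [Fintype n] (h : NegExchangeable Ω)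
    (hS : S ≠ 0) (hT : T ≠ 0) (P : Matrix m (Fin T) ℝ) (Q : Matrix (Fin T) n ℝ) {μ : ℝ}
    (hQ : ∀ j, ∑ i, Q j i ^ 2 ≤ μ) :
    ∑ τ ∈ Ω, ‖(T / S : ℝ) • (P * (maskMatrix τ)ᵀ * ((maskMatrix τ)ᵀᵀ * Q)) - P * Q‖ ^ 2 ≤
      Ω.card * ((T / S : ℝ) * (μ * ‖P‖ ^ 2)) := by
  have hentry : ∀ (τ : Fin S → Fin T) (i : m) (j : n),
      ((T / S : ℝ) • (P * (maskMatrix τ)ᵀ * ((maskMatrix τ)ᵀᵀ * Q)) - P * Q) i j =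
        (T / S : ℝ) * ∑ s, P i (τ s) * Q (τ s) j - ∑ t, P i t * Q t j := by
    intro τ i j
    simp [Matrix.mul_apply, maskMatrix]
  calc ∑ τ ∈ Ω, ‖(T / S : ℝ) • (P * (maskMatrix τ)ᵀ * ((maskMatrix τ)ᵀᵀ * Q)) - P * Q‖ ^ 2
      = ∑ i, ∑ j, ∑ τ ∈ Ω,
          ((T / S : ℝ) * ∑ s, P i (τ s) * Q (τ s) j - ∑ t, P i t * Q t j) ^ 2 := by
        simp only [frobenius_norm_sq, hentry]
        rw [Finset.sum_comm]
        exact Finset.sum_congr rfl fun i _ => Finset.sum_comm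
    _ ≤ ∑ i, ∑ j, Ω.card * ((T / S : ℝ) * ∑ t, (P i t * Q t j) ^ 2) :=
        Finset.sum_le_sum fun i _ => Finset.sum_le_sum fun j _ =>
          h.sum_sq_estimator_le hS hT fun t => P i t * Q t j
    _ = Ω.card * ((T / S : ℝ) * ∑ i, ∑ t, P i t ^ 2 * ∑ j, Q t j ^ 2) := by
        simp only [← Finset.mul_sum]
        congr 2
        refine Finset.sum_congr rfl fun i _ => ?_
        rw [Finset.sum_comm]
        simp only [mul_pow, Finset.mul_sum]
    _ ≤ Ω.card * ((T / S : ℝ) * ∑ i, ∑ t, P i t ^ 2 * μ) := by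
        gcongr with i _ t _
        exact hQ t
    _ = _ := by
        simp only [frobenius_norm_sq, ← Finset.sum_mul]
        ring

end NegExchangeable

/-! ### The two sampling schemes -/

theorem negExchangeable_univ (S T : ℕ) :
    NegExchangeable (Finset.univ : Finset (Fin S → Fin T)) where
  comp_mem := fun _ _ _ => Finset.mem_univ _
  card_diag_le := by
    intro s s' hs a b _
    -- Redirecting draw `s'` from `a` to `b` is injective, since the overwritten value is known.
    refine Finset.card_le_card_of_injOn (fun τ => Function.update τ s' b) ?_ ?_
    · intro τ hτ
      simp only [Finset.coe_filter, Finset.mem_univ, true_and, Set.mem_ofPred_eq] at hτ ⊢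
      simp [Function.update_of_ne hs, hτ.1]
    · intro τ hτ τ' hτ' he
      simp only [Finset.coe_filter, Finset.mem_univ, true_and, Set.mem_ofPred_eq] at hτ hτ'
      funext t
      by_cases ht : t = s'
      · rw [ht, hτ.2, hτ'.2]
      · simpa [Function.update_of_ne ht] using congrFun he t

open Classical in
theorem negExchangeable_injective (S T : ℕ) :
    NegExchangeable (Finset.univ.filter fun τ : Fin S → Fin T => Function.Injective τ) where
  comp_mem := by
    intro τ hτ π
    simp only [Finset.mem_filter, Finset.mem_univ, true_and] at hτ ⊢
    exact π.injective.comp hτ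
  card_diag_le := by
    intro s s' hs a b _
    rw [Finset.card_eq_zero.mpr]
    · exact Nat.zero_le _
    · refine Finset.filter_eq_empty_iff.mpr fun τ hτ h => hs ?_
      exact (Finset.mem_filter.mp hτ).2 (h.1.trans h.2.symm)

/-! ### Probability bounds -/

/-- Markov's inequality. The case `t = 0` is needed when `A = A_k`: the sum is then zero, so `φ`
vanishes on `Ω`. -/
theorem card_filter_lt_le_of_sum_le {α : Type*} (Ω : Finset α) {φ : α → ℝ} (hφ : ∀ τ, 0 ≤ φ τ)
    {t η : ℝ} (ht : 0 ≤ t) (hsum : ∑ τ ∈ Ω, φ τ ≤ Ω.card * (η * t)) (hη : 0 ≤ η) :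
    ((Ω.filter fun τ => t < φ τ).card : ℝ) ≤ η * Ω.card := by
  rcases ht.eq_or_lt with rfl | ht
  · have h0 : ∑ τ ∈ Ω, φ τ = 0 :=
      le_antisymm (by simpa using hsum) (Finset.sum_nonneg fun τ _ => hφ τ)
    have h1 := (Finset.sum_eq_zero_iff_of_nonneg fun τ _ => hφ τ).mp h0
    rw [Finset.filter_eq_empty_iff.mpr fun τ hτ => by simp [h1 τ hτ]]
    simp only [Finset.card_empty, Nat.cast_zero]
    positivity
  · have h1 : ((Ω.filter fun τ => t < φ τ).card : ℝ) * t ≤ ∑ τ ∈ Ω, φ τ := by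
      calc ((Ω.filter fun τ => t < φ τ).card : ℝ) * t
          = ∑ τ ∈ Ω.filter fun τ => t < φ τ, t := by simp
        _ ≤ ∑ τ ∈ Ω.filter fun τ => t < φ τ, φ τ :=
            Finset.sum_le_sum fun τ hτ => (Finset.mem_filter.mp hτ).2.le
        _ ≤ _ := Finset.sum_le_sum_of_subset_of_nonneg (Finset.filter_subset _ _)
            fun τ _ _ => hφ τ
    have h2 := h1.trans hsum
    refine le_of_mul_le_mul_right ?_ ht
    linarith

theorem one_sub_le_uniformOn_real {α : Type*} [Fintype α] [MeasurableSpace α]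
    [MeasurableSingletonClass α] {Ω : Finset α} (hΩ : Ω.Nonempty) {δ : ℝ} {φ ψ : α → ℝ}
    {t u : ℝ} {G : Set α}
    (hφ : ((Ω.filter fun τ => t < φ τ).card : ℝ) ≤ δ / 2 * Ω.card)
    (hψ : ((Ω.filter fun τ => u < ψ τ).card : ℝ) ≤ δ / 2 * Ω.card)
    (hG : ∀ τ, φ τ ≤ t → ψ τ ≤ u → τ ∈ G) :
    1 - δ ≤ (ProbabilityTheory.uniformOn (Ω : Set α)).real G := by
  classical
  have hpos : (0 : ℝ) < Ω.card := by exact_mod_cast hΩ.card_pos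
  have hGf : G = ((Finset.univ.filter fun τ => τ ∈ G : Finset α) : Set α) := by ext; simp
  rw [MeasureTheory.measureReal_def, hGf, ProbabilityTheory.uniformOn_apply_finset,
    ENNReal.toReal_div, ENNReal.toReal_natCast, ENNReal.toReal_natCast, le_div_iff₀ hpos]
  have hsub : Ω ⊆ (Ω ∩ Finset.univ.filter fun τ => τ ∈ G) ∪
      ((Ω.filter fun τ => t < φ τ) ∪ (Ω.filter fun τ => u < ψ τ)) := by
    intro τ hτ
    by_cases h1 : t < φ τ
    · simp [hτ, h1]
    by_cases h2 : u < ψ τ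
    · simp [hτ, h2]
    · simp [hτ, hG τ (not_lt.mp h1) (not_lt.mp h2)]
  have hcard := (Finset.card_le_card hsub).trans
    ((Finset.card_union_le _ _).trans (Nat.add_le_add_left (Finset.card_union_le _ _) _))
  have hcard' : (Ω.card : ℝ) ≤ (Ω ∩ Finset.univ.filter fun τ => τ ∈ G).card +
      ((Ω.filter fun τ => t < φ τ).card + (Ω.filter fun τ => u < ψ τ).card) := by
    exact_mod_cast hcard
  linarith

/-! ### Splitting a singular value decomposition -/

namespace CompactSVD

variable {N T : ℕ} {A : Matrix (Fin N) (Fin T) ℝ}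

/-- The matrix `V_k` of the top `k` right singular vectors. -/
def topV (D : CompactSVD A) (k : ℕ) : Matrix (Fin T) {i : Fin D.r // (i : ℕ) < k} ℝ :=
  D.V.submatrix id Subtype.val

theorem topV_orthonormal (D : CompactSVD A) (k : ℕ) : (D.topV k)ᵀ * D.topV k = 1 := by
  have h : (D.topV k)ᵀ * D.topV k = (D.Vᵀ * D.V).submatrix Subtype.val Subtype.val := by
    ext i j
    simp [topV, Matrix.mul_apply]
  rw [h, D.V_orthonormal, Matrix.submatrix_one _ Subtype.val_injective]

theorem truncate_eq_mul_topV (D : CompactSVD A) (k : ℕ) :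
    ∃ B : Matrix (Fin N) {i : Fin D.r // (i : ℕ) < k} ℝ,
      D.truncate k = B * (D.topV k)ᵀ := by
  refine ⟨(D.U * Matrix.diagonal D.σ).submatrix id Subtype.val, ?_⟩
  ext n t
  have hl : D.truncate k n t =
      ∑ i : Fin D.r, if (i : ℕ) < k then D.U n i * D.σ i * D.V t i else 0 := by
    rw [truncate, Matrix.mul_apply]
    refine Finset.sum_congr rfl fun i _ => ?_
    rw [Matrix.mul_diagonal, Matrix.transpose_apply]
    split_ifs <;> simp
  rw [hl, ← Finset.sum_filter, Finset.sum_subtype (p := fun i : Fin D.r => (i : ℕ) < k) _ (by simp),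
    Matrix.mul_apply]
  refine Finset.sum_congr rfl fun i _ => ?_
  rw [Matrix.submatrix_apply, Matrix.mul_diagonal]
  rfl

/-- The residual involves only the remaining right singular vectors, orthogonal to the top ones. -/
theorem sub_truncate_mul_topV (D : CompactSVD A) (k : ℕ) :
    (A - D.truncate k) * D.topV k = 0 := by
  have h1 : A - D.truncate k =
      D.U * Matrix.diagonal (fun i : Fin D.r => if (i : ℕ) < k then 0 else D.σ i) * D.Vᵀ := by
    nth_rewrite 1 [D.eq_mul]
    rw [truncate, ← Matrix.sub_mul, ← Matrix.mul_sub, Matrix.diagonal_sub]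
    congr 3
    funext i
    split_ifs <;> simp
  have h2 : D.Vᵀ * D.topV k = (1 : Matrix (Fin D.r) (Fin D.r) ℝ).submatrix id Subtype.val := by
    rw [← D.V_orthonormal]
    ext i j
    simp [topV, Matrix.mul_apply]
  rw [h1, Matrix.mul_assoc, h2, Matrix.mul_assoc]
  convert Matrix.mul_zero _
  ext i j
  rw [Matrix.diagonal_mul, Matrix.submatrix_apply, Matrix.zero_apply, id_eq]
  split_ifs with hi
  · simp
  · rw [Matrix.one_apply_ne, mul_zero]
    exact fun h => hi (h ▸ j.2)

theorem sum_sq_topV_le_coherence (D : CompactSVD A) (k : ℕ) (j : Fin T) :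
    ∑ i, D.topV k j i ^ 2 ≤ D.coherence k := by
  have h : ∑ i, D.topV k j i ^ 2 = ∑ i : Fin D.r, if (i : ℕ) < k then D.V j i ^ 2 else 0 := by
    rw [← Finset.sum_filter]
    exact (Finset.sum_subtype (Finset.univ.filter fun i : Fin D.r => (i : ℕ) < k) (by simp)
      (fun i => D.V j i ^ 2)).symm
  rw [h]
  exact le_ciSup (f := fun j => ∑ i : Fin D.r, if (i : ℕ) < k then D.V j i ^ 2 else 0)
    (Set.finite_range _).bddAbove j

theorem norm_transpose_topV_sq_le (D : CompactSVD A) (k : ℕ) : ‖(D.topV k)ᵀ‖ ^ 2 ≤ k := by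
  rw [frobenius_norm_sq_eq_trace, Matrix.transpose_transpose, Matrix.trace_mul_comm,
    D.topV_orthonormal, Matrix.trace_one]
  have := Fintype.card_le_of_injective
    (fun i : {i : Fin D.r // (i : ℕ) < k} => (⟨i.1, i.2⟩ : Fin k))
    (fun i j h => Subtype.ext (Fin.ext (by simpa using h)))
  rw [Fintype.card_fin] at this
  exact_mod_cast this

end CompactSVD

/-! ### Assembling the error bound -/

/-- Approximate multiplication by the top right singular vectors, under a coherence bound. -/
theorem sum_norm_sq_sampled_mul_topV_le {N T k S : ℕ} {A : Matrix (Fin N) (Fin T) ℝ}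
    (D : CompactSVD A) {c η t : ℝ} (hT : T ≠ 0) (hcoh : D.coherence k ≤ c * ((k : ℝ) / (T : ℝ)))
    {Ω : Finset (Fin S → Fin T)} (hΩ : NegExchangeable Ω) {m : Type*} [Fintype m]
    (P : Matrix m (Fin T) ℝ) (hk : S = 0 → k = 0) (ht : 0 ≤ η * t)
    (hP : c * k * ‖P‖ ^ 2 ≤ η * t * S) :
    ∑ τ ∈ Ω, ‖(T / S : ℝ) • (P * (maskMatrix τ)ᵀ * ((maskMatrix τ)ᵀᵀ * D.topV k))
      - P * D.topV k‖ ^ 2 ≤ Ω.card * (η * t) := by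
  by_cases hS : S = 0
  · have hempty : IsEmpty {i : Fin D.r // (i : ℕ) < k} := 
      ⟨fun i => Nat.not_lt_zero _ (lt_of_lt_of_eq i.2 (hk hS))⟩
    refine le_of_eq_of_le (Finset.sum_eq_zero fun τ _ => ?_) (by positivity)
    rw [frobenius_norm_sq]
    simp
  · have hS' : (0 : ℝ) < S := by positivity
    refine (hΩ.sum_norm_sq_sampled_mul_le hS hT P (D.topV k)
      fun j => (D.sum_sq_topV_le_coherence k j).trans hcoh).trans ?_
    refine mul_le_mul_of_nonneg_left ?_ (Nat.cast_nonneg _)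
    calc (T / S : ℝ) * (c * (k / T) * ‖P‖ ^ 2) = c * k * ‖P‖ ^ 2 / S := by field_simp
      _ ≤ η * t := (div_le_iff₀ hS').mpr hP

/-- The error bound for any negatively exchangeable family of samples. -/
theorem one_sub_le_uniformOn_columnProjection_error {N T d k S : ℕ}
    {A : Matrix (Fin N) (Fin T) ℝ} (W : Matrix (Fin T) (Fin d) ℝ) (D : CompactSVD A)
    {c δ ε : ℝ} (hc : 0 < c) (hδ : 0 < δ) (hε : 0 < ε) (hε1 : ε ≤ 1) (hT : T ≠ 0)
    (hcoh : D.coherence k ≤ c * ((k : ℝ) / (T : ℝ)))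
    (hS : 8 * c / δ * ((k : ℝ) ^ 2 / ε ^ 2) ≤ (S : ℝ))
    {Ω : Finset (Fin S → Fin T)} (hΩ : NegExchangeable Ω) (hne : Ω.Nonempty) :
    1 - δ ≤ (ProbabilityTheory.uniformOn (Ω : Set (Fin S → Fin T))).real
      {τ | ‖A * W - columnProjection (sampledColumns A τ) A * W‖
        ≤ (1 + ε) * ‖W‖ * ‖A - D.truncate k‖} := by
  set E := A - D.truncate k with hE
  set V := D.topV k with hV
  -- The 8 is the failure share `δ / 2` times the squared thresholds `1 / 4` and `ε² / 4 * ‖E‖²`.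
  -- The Gram matrix needs `S` of order `k²`, the residual only `k / ε²`; `k² / ε²` covers both.
  have hS8 : 8 * c * (k : ℝ) ^ 2 ≤ δ * ε ^ 2 * S := by
    rw [div_mul_div_comm, div_le_iff₀ (by positivity)] at hS
    linarith
  have hk : S = 0 → k = 0 := by
    rintro rfl
    by_contra hk
    have : 0 < 8 * c * (k : ℝ) ^ 2 := by positivity
    simp only [Nat.cast_zero, mul_zero] at hS8
    linarith
  obtain ⟨B, hB⟩ := D.truncate_eq_mul_topV k
  refine one_sub_le_uniformOn_real hne (t := (1 / 2) ^ 2) (u := (ε / 2 * ‖E‖) ^ 2)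
    (φ := fun τ => ‖(T / S : ℝ) • (Vᵀ * (maskMatrix τ)ᵀ * ((maskMatrix τ)ᵀᵀ * V)) - Vᵀ * V‖ ^ 2)
    (ψ := fun τ => ‖(T / S : ℝ) • (E * (maskMatrix τ)ᵀ * ((maskMatrix τ)ᵀᵀ * V)) - E * V‖ ^ 2)
    ?_ ?_ ?_
  · refine card_filter_lt_le_of_sum_le Ω (fun τ => by positivity) (by positivity)
      (sum_norm_sq_sampled_mul_topV_le D hT hcoh hΩ _ hk (by positivity) ?_) (by positivity)
    have h1 : c * k * ‖Vᵀ‖ ^ 2 ≤ c * k * k := by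
      gcongr
      exact D.norm_transpose_topV_sq_le k
    have h2 : δ * ε ^ 2 * S ≤ δ * 1 * S := by
      gcongr
      exact pow_le_one₀ hε.le hε1
    linarith
  · refine card_filter_lt_le_of_sum_le Ω (fun τ => by positivity) (by positivity)
      (sum_norm_sq_sampled_mul_topV_le D hT hcoh hΩ _ hk (by positivity) ?_) (by positivity)
    have h1 : (k : ℝ) ≤ (k : ℝ) ^ 2 := by exact_mod_cast Nat.le_self_pow two_ne_zero k
    have h2 : 8 * c * k ≤ δ * ε ^ 2 * S := le_trans (by gcongr) hS8
    have h3 := mul_le_mul_of_nonneg_right h2 (sq_nonneg ‖E‖)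
    linarith
  · intro τ h1 h2
    rw [sq_le_sq₀ (by positivity) (by positivity)] at h1 h2
    rw [D.topV_orthonormal] at h1
    rw [D.sub_truncate_mul_topV, sub_zero] at h2
    have h := frobenius_norm_sub_columnProjection_le_of_close (A := A) (E := E)
      (D.topV_orthonormal k) (by rw [← hB, hE]; abel) (maskMatrix τ)ᵀ _ ε h1 h2
    rw [Set.mem_ofPred_eq, ← Matrix.sub_mul]
    refine (Matrix.frobenius_norm_mul _ _).trans ?_
    rw [mul_right_comm]
    exact mul_le_mul_of_nonneg_right h (norm_nonneg _)

theorem mainTheorem6 (c δ : ℝ) (hc : 0 < c) (hδ : 0 < δ) (hδ' : δ < 1) :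
    ∃ C : ℝ, 0 < C ∧
      ∀ (N T d k S : ℕ) (A : Matrix (Fin N) (Fin T) ℝ) (W : Matrix (Fin T) (Fin d) ℝ)
        (D : CompactSVD A) (ε : ℝ),
        0 < ε → ε ≤ 1 → S < T →
        D.coherence k ≤ c * ((k : ℝ) / (T : ℝ)) →
        C * ((k : ℝ) ^ 2 / ε ^ 2) ≤ (S : ℝ) →
        -- sampling without replacement: a uniformly random injective selection
        1 - δ ≤ (ProbabilityTheory.uniformOn {τ : Fin S → Fin T | Function.Injective τ}).real
            {τ | ‖A * W - columnProjection (sampledColumns A τ) A * W‖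
              ≤ (1 + ε) * ‖W‖ * ‖A - D.truncate k‖} ∧
        -- independent uniform sampling with replacement
        1 - δ ≤ (ProbabilityTheory.uniformOn (Set.univ : Set (Fin S → Fin T))).real
            {τ | ‖A * W - columnProjection (sampledColumns A τ) A * W‖
              ≤ (1 + ε) * ‖W‖ * ‖A - D.truncate k‖} := by
  classical
  refine ⟨8 * c / δ, by positivity, fun N T d k S A W D ε hε hε1 hST hcoh hS => ⟨?_, ?_⟩⟩
  · have h := one_sub_le_uniformOn_columnProjection_error W D hc hδ hε hε1 (by lia) hcoh hS
      (negExchangeable_injective S T)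
      ⟨Fin.castLE hST.le, by simp [Fin.castLE_injective]⟩
    simpa using h
  · have : NeZero T := ⟨by lia⟩
    have h := one_sub_le_uniformOn_columnProjection_error W D hc hδ hε hε1 (by lia) hcoh hS
      (negExchangeable_univ S T) Finset.univ_nonempty
    simpa only [Finset.coe_univ] using h
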